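/- Throughout, $\log$ is the logarithm to base $2$. A private coin simultaneous message protocol $\Pi$ for a function $g:\mathcal X\times\mathcal Y\to\mathcal Z$ ($\mathcal X,\mathcal Y$ finite and nonempty) works as follows: on input $x\in\mathcal X$ Alice sends a random bit string of fixed length $\ell_A$, on input $y\in\mathcal Y$ Bob sends a random bit string of fixed length $\ell_B$, where the two messages are generated with independent private coins, and a referee who sees only the two messages determines the answer from them by a fixed rule. The cost of $\Pi$ is $\ell_A+\ell_B$, and $\Pi$ is a $\delta$-error protocol for $g$ if for every $(x,y)$ the answer equals $g(x,y)$ with probability at least $1-\delta$. Let $R^{\mathrm{sim}}_\delta(g)$ be the minimum cost of a $\delta$-error protocol for $g$. Let $\mathrm{IC}^{\mathrm{sim}}_\delta(g)$ be the infimum, over all $\delta$-error protocols $\Pi$ for $g$, of the mutual information $I(XY:\Pi(X,Y))$, where $(X,Y)$ is uniform on $\mathcal X\times\mathcal Y$ and $\Pi(x,y)$ is the pair of messages sent on input $(x,y)$. For $m\ge 0$ let $g^m:\mathcal X^m\times\mathcal Y^m\to\mathcal Z^m$ be $g^m((x_i)_i,(y_i)_i)=(g(x_i,y_i))_i$. Let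 $n\ge 0$, let $f:\{0,1\}^n\times\{0,1\}^n\to\mathcal Z$ be a function, and let $\delta>0$ and $0<\epsilon<1$. (i) There exist sets $\mathsf{Good}_A,\mathsf{Good}_B\subseteq\{0,1\}^n$ with $|\mathsf{Good}_A|\ge\frac23\cdot 2^n$ and $|\mathsf{Good}_B|\ge\frac23\cdot 2^n$ such that $$\mathrm{IC}^{\mathrm{sim}}_\delta(f)\ \ge\ \frac{\epsilon}{3}\Bigl(R^{\mathrm{sim}}_{\delta+4\epsilon}(f')-2\log(n+1)-2\log\frac{1}{\epsilon^2(1-\epsilon)}-\frac2\epsilon-8\Bigr),$$ where $f'$ is the restriction of $f$ to $\mathsf{Good}_A\times\mathsf{Good}_B$. (ii) Let $\tilde R^{\mathrm{sim}}_{\eta}(f)=\min_{A,B}R^{\mathrm{sim}}_{\eta}(f|_{A\times B})$, where $A,B$ range over the subsets of $\{0,1\}^n$ with $|A|,|B|\ge\frac23\cdot 2^n$. Then for every integer $m\ge 0$, $$R^{\mathrm{sim}}_\delta(f^m)\ \ge\ \frac{m\epsilon}{3}\Bigl(\tilde R^{\mathrm{sim}}_{\delta+4\epsilon}(f)-2\log(n+1)-2\log\frac{1}{\epsilon^2(1-\epsilon)}-\frac2\epsilon-8\Bigr).$$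 -/

import Mathlib

/-- Shannon entropy, in bits, of a distribution on a finite set. -/
noncomputable def shannonEntropy {α : Type*} [Fintype α] (p : PMF α) : ℝ :=
  -∑ a, (p a).toReal * Real.logb 2 (p a).toReal

/-- Mutual information `I(U : V) = H(U) + H(V) - H(UV)`, in bits, of a pair of random variables
with joint distribution `p`. -/
noncomputable def mutualInfo {α β : Type*} [Fintype α] [Fintype β] (p : PMF (α × β)) : ℝ :=
  shannonEntropy (p.map Prod.fst) + shannonEntropy (p.map Prod.snd) - shannonEntropy p

/-- A private coin simultaneous message protocol with inputs in `X`, `Y` and outputs in `Z`.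
On input `x` Alice tosses her private coins and sends the referee a string of `lenA` bits, and
independently Bob sends a string of `lenB` bits on input `y`; only the distribution of each
message given the sender's input matters. The referee sees the two messages and nothing else. -/
structure SimProtocol (X Y Z : Type*) where
  lenA : ℕ
  lenB : ℕ
  alice : X → PMF (Fin lenA → Bool)
  bob : Y → PMF (Fin lenB → Bool)
  referee : (Fin lenA → Bool) → (Fin lenB → Bool) → Z

namespace SimProtocol

variable {X Y Z : Type*}

/-- Communication cost: the total number of bits sent. -/
def cost (P : SimProtocol X Y Z) : ℕ := P.lenA + P.lenB

/-- Distribution of the transcript (the pair of messages) on input `(x, y)`: the private coins of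
Alice and Bob are independent. -/
noncomputable def transcript (P : SimProtocol X Y Z) (x : X) (y : Y) :
    PMF ((Fin P.lenA → Bool) × (Fin P.lenB → Bool)) :=
  (P.alice x).bind fun u => (P.bob y).map fun v => (u, v)

open Classical in
/-- The probability, over the coin tosses of Alice and Bob, that the referee announces `z` on
input `(x, y)`. -/
noncomputable def probOutput (P : SimProtocol X Y Z) (x : X) (y : Y) (z : Z) : ℝ :=
  ∑ t, if P.referee t.1 t.2 = z then (P.transcript x y t).toReal else 0

/-- `P` is a `δ`-error protocol for `f`: on every input the answer is correct with probability at
least `1 - δ`. -/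
def Computes (P : SimProtocol X Y Z) (f : X → Y → Z) (δ : ℝ) : Prop :=
  ∀ x y, 1 - δ ≤ P.probOutput x y (f x y)

/-- Joint distribution of the input pair, drawn from `μ`, and the transcript on that input. -/
noncomputable def joint (P : SimProtocol X Y Z) (μ : PMF (X × Y)) :
    PMF ((X × Y) × ((Fin P.lenA → Bool) × (Fin P.lenB → Bool))) :=
  μ.bind fun xy => (P.transcript xy.1 xy.2).map fun t => (xy, t)

/-- Information cost `I(XY : Π(X, Y))` of the protocol under the input distribution `μ`. -/
noncomputable def infoCost [Fintype X] [Fintype Y] (P : SimProtocol X Y Z) (μ : PMF (X × Y)) : ℝ :=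
  mutualInfo (P.joint μ)

end SimProtocol

/-- `R^sim_δ(f)`: the least cost of a private coin simultaneous `δ`-error protocol for `f`. -/
noncomputable def Rsim {X Y Z : Type*} (δ : ℝ) (f : X → Y → Z) : ℕ :=
  sInf {c | ∃ P : SimProtocol X Y Z, P.Computes f δ ∧ P.cost = c}

/-- `IC^sim_δ(f)`: the infimum information cost, under the uniform distribution on the inputs, of
a private coin simultaneous `δ`-error protocol for `f`. -/
noncomputable def ICsim {X Y Z : Type*} [Fintype X] [Nonempty X] [Fintype Y] [Nonempty Y]
    (δ : ℝ) (f : X → Y → Z) : ℝ :=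
  sInf {r | ∃ P : SimProtocol X Y Z, P.Computes f δ ∧
    P.infoCost (PMF.uniformOfFintype (X × Y)) = r}

/-- The restriction of `f` to `A × B`. -/
def restrictRect {X Y Z : Type*} (f : X → Y → Z) (A : Finset X) (B : Finset Y) : A → B → Z :=
  fun x y => f x y

/-- `S` contains at least two thirds of all `n`-bit strings. -/
def IsLarge {n : ℕ} (S : Finset (Fin n → Bool)) : Prop :=
  (2 / 3 : ℝ) * 2 ^ n ≤ (S.card : ℝ)

/-- `R̃^sim_δ(f)`: the minimum of `R^sim_δ` over the restrictions of `f` to rectangles with both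
sides large. -/
noncomputable def RsimTilde {n : ℕ} {Z : Type*} (δ : ℝ)
    (f : (Fin n → Bool) → (Fin n → Bool) → Z) : ℕ :=
  sInf {c | ∃ A B : Finset (Fin n → Bool), IsLarge A ∧ IsLarge B ∧
    Rsim δ (restrictRect f A B) = c}

/-- The `m`-fold direct sum `f^m`. -/
def directSumFun {X Y Z : Type*} (m : ℕ) (f : X → Y → Z) :
    (Fin m → X) → (Fin m → Y) → (Fin m → Z) :=
  fun x y i => f (x i) (y i)

/-!
With uniform inputs, the information cost of a protocol is the sum of the informations that Alice's
and Bob's messages carry about their inputs, and the information of each player is the average over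
the inputs of the divergence of the message from its overall distribution `q`.

Small divergence allows compression. By Markov's inequality, for two thirds of the inputs the
divergence is at most three times its average `a`; then, outside an event of probability `ε`, no
message is more than `2 ^ ((3 * a + 1) / ε)` times as likely as under `q`, so rejection sampling
accepts a `q`-random sample with probability about the reciprocal of this factor. Draw a list of
`q`-random samples moderately longer than the factor and let Alice send an index into the list,
chosen with probability proportional to the acceptance probability of the sample. For a given pair
of inputs the error then grows by at most `2 * ε`, except with a probability so small (by the
exponential moment method) that one list serves all pairs at once. The index is short, and the
same argument then applies to Bob.

A protocol for `m` copies yields, for each `i`, a protocol for one copy that plants its input in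
coordinate `i`. As the coordinates of a uniform input are independent, the information costs of
these protocols add up to at most that of the whole protocol, hence to at most its length.
-/

open Finset Real
open Function (support)
open scoped BigOperators

section RelativeEntropy

variable {M N ι : Type*} [Fintype M] [Fintype N] [Fintype ι] {p q : M → ℝ}

/-- Relative entropy, in bits, of two nonnegative functions on a finite set, which need not be
normalised. It is only meaningful when `q` is nonzero wherever `p` is, since the junk value of
`p m / 0` would otherwise hide an infinite term. -/
noncomputable def relEntropy (p q : M → ℝ) : ℝ := ∑ m, p m * logb 2 (p m / q m)

theorem sub_div_log_two_le_mul_logb_div {a b : ℝ} (ha : 0 ≤ a) (hb : 0 ≤ b) (hab : a ≠ 0 → b ≠ 0) :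
    (a - b) / log 2 ≤ a * logb 2 (a / b) := by
  rcases hb.eq_or_lt with rfl | hb
  · have : a = 0 := by_contra fun h => hab h rfl
    simp [this]
  rw [logb, ← mul_div_assoc]
  gcongr
  calc a - b = b * (a / b - 1) := by field_simp
    _ ≤ b * (a / b * log (a / b)) := by gcongr; exact self_sub_one_le_mul_log (by positivity)
    _ = a * log (a / b) := by field_simp

theorem sum_sub_sum_div_log_two_le_relEntropy (hp : ∀ m, 0 ≤ p m) (hq : ∀ m, 0 ≤ q m)
    (hpq : support p ⊆ support q) : (∑ m, p m - ∑ m, q m) / log 2 ≤ relEntropy p q := by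
  rw [← sum_sub_distrib, sum_div]
  exact sum_le_sum fun m _ => sub_div_log_two_le_mul_logb_div (hp m) (hq m) (@hpq m)

theorem relEntropy_nonneg (hp : ∀ m, 0 ≤ p m) (hq : ∀ m, 0 ≤ q m) (hpq : support p ⊆ support q)
    (hsum : ∑ m, q m ≤ ∑ m, p m) : 0 ≤ relEntropy p q :=
  (div_nonneg (sub_nonneg.2 hsum) (log_pos one_lt_two).le).trans
    (sum_sub_sum_div_log_two_le_relEntropy hp hq hpq)

theorem relEntropy_eq_sub (hpq : support p ⊆ support q) :
    relEntropy p q = ∑ m, p m * logb 2 (p m) - ∑ m, p m * logb 2 (q m) := by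
  rw [relEntropy, ← sum_sub_distrib]
  refine sum_congr rfl fun m _ => ?_
  rcases eq_or_ne (p m) 0 with h | h
  · simp [h]
  · rw [logb_div h (hpq h), mul_sub]

theorem relEntropy_mul_mul {p' q' : N → ℝ} (hpq : support p ⊆ support q)
    (hpq' : support p' ⊆ support q') :
    relEntropy (fun x : M × N => p x.1 * p' x.2) (fun x => q x.1 * q' x.2)
      = relEntropy p q * ∑ n, p' n + (∑ m, p m) * relEntropy p' q' := by
  simp only [relEntropy, Fintype.sum_prod_type, sum_mul_sum, ← sum_add_distrib]
  refine sum_congr rfl fun m _ => sum_congr rfl fun n _ => ?_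
  rcases eq_or_ne (p m) 0 with h | h
  · simp [h]
  rcases eq_or_ne (p' n) 0 with h' | h'
  · simp [h']
  rw [mul_div_mul_comm, logb_mul (div_ne_zero h (hpq h)) (div_ne_zero h' (hpq' h'))]
  ring

theorem relEntropy_mul_prod_div {r : ι → M → ℝ} (hpq : support p ⊆ support q)
    (hpr : ∀ i, support p ⊆ support (r i)) :
    relEntropy p (fun m => q m * ∏ i, r i m / q m)
      = relEntropy p q - ∑ i, ∑ m, p m * logb 2 (r i m / q m) := by
  rw [sum_comm, relEntropy, relEntropy, ← sum_sub_distrib]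
  refine sum_congr rfl fun m _ => ?_
  rcases eq_or_ne (p m) 0 with h | h
  · simp [h]
  have hr : ∀ i ∈ univ, r i m / q m ≠ 0 := fun i _ => div_ne_zero (hpr i h) (hpq h)
  rw [← div_div, logb_div (div_ne_zero h (hpq h)) (prod_ne_zero_iff.2 hr), logb_prod _ _ hr,
    mul_sub, mul_sum]

theorem neg_le_mul_logb_div {a b : ℝ} (ha : 0 ≤ a) (hb : 0 ≤ b) (hab : a ≠ 0 → b ≠ 0) :
    -b ≤ a * logb 2 (a / b) := by
  rcases ha.eq_or_lt with rfl | ha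
  · simpa using hb
  have hb : 0 < b := hb.lt_of_ne' (hab ha.ne')
  have hlog : 1 / 2 ≤ log 2 := by linarith [log_two_gt_d9]
  have hlog' : log 2 ≤ 1 := by linarith [log_two_lt_d9]
  -- Gibbs against `b / 2` rather than `b` gains a summand `a`, enough to absorb `a / log 2 - a`.
  have hhalf := sub_div_log_two_le_mul_logb_div ha.le (half_pos hb).le fun _ => (half_pos hb).ne'
  rw [div_div_eq_mul_div, mul_div_right_comm, logb_mul (by positivity) two_ne_zero,
    logb_self_eq_one one_lt_two, div_le_iff₀ (by linarith)] at hhalf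
  by_contra! hlt
  nlinarith

theorem mul_sum_filter_sub_sum_le_relEntropy (hp : ∀ m, 0 ≤ p m) (hq : ∀ m, 0 ≤ q m)
    (hpq : support p ⊆ support q) (k : ℝ) :
    k * ∑ m with (2 : ℝ) ^ k * q m < p m, p m - ∑ m, q m ≤ relEntropy p q := by
  rw [relEntropy, sum_filter, mul_sum, ← sum_sub_distrib]
  refine sum_le_sum fun m _ => ?_
  split_ifs with hlt
  · have hpm : 0 < p m := (mul_nonneg (by positivity) (hq m)).trans_lt hlt
    have hqm : 0 < q m := (hq m).lt_of_ne' (hpq hpm.ne')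
    have hk : k ≤ logb 2 (p m / q m) := by
      rw [le_logb_iff_rpow_le one_lt_two (by positivity), le_div_iff₀ hqm]
      exact hlt.le
    nlinarith
  · simpa using neg_le_mul_logb_div (hp m) (hq m) (@hpq m)

theorem sum_filter_rpow_mul_lt_le_of_relEntropy_le (hp : ∀ m, 0 ≤ p m) (hq : ∀ m, 0 ≤ q m)
    (hpq : support p ⊆ support q) (hq1 : ∑ m, q m ≤ 1) {d ε : ℝ} (hd : 0 ≤ d)
    (hD : relEntropy p q ≤ d) (hε : 0 < ε) :
    ∑ m with (2 : ℝ) ^ ((d + 1) / ε) * q m < p m, p m ≤ ε := by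
  have htail := mul_sum_filter_sub_sum_le_relEntropy hp hq hpq ((d + 1) / ε)
  have hk : 0 < (d + 1) / ε := by positivity
  refine le_of_mul_le_mul_left ?_ hk
  rw [div_mul_cancel₀ _ hε.ne']
  linarith

end RelativeEntropy

section Mass

variable {M W : Type*}

/-- The probability mass function of a distribution as a real-valued function, so that
probabilities can be averaged, subtracted and fed to logarithms. -/
noncomputable def mass (p : PMF M) (m : M) : ℝ := (p m).toReal

theorem mass_nonneg (p : PMF M) (m : M) : 0 ≤ mass p m := ENNReal.toReal_nonneg

theorem mass_le_one (p : PMF M) (m : M) : mass p m ≤ 1 :=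
  ENNReal.toReal_le_of_le_ofReal zero_le_one (by simpa using p.coe_le_one m)

open Classical in
theorem mass_pure (a m : M) : mass (PMF.pure a) m = if m = a then 1 else 0 := by
  rw [mass, PMF.pure_apply, apply_ite ENNReal.toReal, ENNReal.toReal_one, ENNReal.toReal_zero]

theorem mass_bind [Fintype W] (μ : PMF W) (κ : W → PMF M) (m : M) :
    mass (μ.bind κ) m = ∑ w, mass μ w * mass (κ w) m := by
  simp only [mass, PMF.bind_apply, tsum_fintype]
  rw [ENNReal.toReal_sum fun w _ => ENNReal.mul_ne_top (μ.apply_ne_top w) ((κ w).apply_ne_top m)]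
  simp only [ENNReal.toReal_mul]

/-- The joint distribution of a `μ`-random `w` and a `κ w`-random `m`. -/
noncomputable def jointPMF (μ : PMF W) (κ : W → PMF M) : PMF (W × M) :=
  μ.bind fun w => (κ w).map fun m => (w, m)

theorem map_fst_jointPMF (μ : PMF W) (κ : W → PMF M) : (jointPMF μ κ).map Prod.fst = μ := by
  have hconst (w : W) : ((κ w).map fun m => (w, m)).map Prod.fst = PMF.pure w := by
    rw [PMF.map_comp]
    exact PMF.map_const _ _
  simp only [jointPMF, PMF.map_bind, hconst, PMF.bind_pure]

theorem map_snd_jointPMF (μ : PMF W) (κ : W → PMF M) :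
    (jointPMF μ κ).map Prod.snd = μ.bind κ := by
  have hid (w : W) : ((κ w).map fun m => (w, m)).map Prod.snd = κ w := by
    rw [PMF.map_comp]
    exact PMF.map_id _
  simp only [jointPMF, PMF.map_bind, hid]

theorem mass_jointPMF (μ : PMF W) (κ : W → PMF M) (x : W × M) :
    mass (jointPMF μ κ) x = mass μ x.1 * mass (κ x.1) x.2 := by
  classical
  obtain ⟨w, m⟩ := x
  have hmap (w' : W) : (κ w').map (fun m => (w', m)) (w, m) = if w = w' then κ w m else 0 := by
    rcases eq_or_ne w w' with rfl | hw
    · simp [PMF.map_apply]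
    · simp [PMF.map_apply, hw]
  rw [mass, jointPMF, PMF.bind_apply, tsum_eq_single w, hmap, if_pos rfl, ENNReal.toReal_mul]
  · rfl
  · intro w' hw
    rw [hmap, if_neg hw.symm, mul_zero]

variable [Fintype M] [Fintype W]

theorem sum_mass (p : PMF M) : ∑ m, mass p m = 1 := by
  simp only [mass]
  rw [← ENNReal.toReal_sum fun m _ => p.apply_ne_top m, ← tsum_fintype (L := .unconditional M),
    p.tsum_coe, ENNReal.toReal_one]

theorem sum_mass_mul_mem_Icc (p : PMF M) {h : M → ℝ} (hh : ∀ m, h m ∈ Set.Icc 0 1) :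
    ∑ m, mass p m * h m ∈ Set.Icc (0 : ℝ) 1 :=
  (convex_Icc 0 1).sum_mem (fun m _ => mass_nonneg p m) (sum_mass p) fun m _ => hh m

theorem shannonEntropy_eq_neg_sum_mass (p : PMF M) :
    shannonEntropy p = -∑ m, mass p m * logb 2 (mass p m) := rfl

theorem shannonEntropy_nonneg (p : PMF M) : 0 ≤ shannonEntropy p :=
  neg_nonneg.2 <| sum_nonpos fun m _ => mul_nonpos_of_nonneg_of_nonpos (mass_nonneg p m)
    (logb_nonpos one_lt_two (mass_nonneg p m) (mass_le_one p m))

theorem shannonEntropy_le_logb_card (p : PMF M) : shannonEntropy p ≤ logb 2 (Fintype.card M) := by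
  have : Nonempty M := p.support_nonempty.to_type
  have hsupp : support (mass p) ⊆ support fun _ : M => (Fintype.card M : ℝ)⁻¹ := by simp
  have hgibbs := relEntropy_nonneg (mass_nonneg p) (fun _ => by positivity) hsupp
    (by simp [sum_mass])
  rw [relEntropy_eq_sub hsupp, ← sum_mul, sum_mass, one_mul, logb_inv] at hgibbs
  rw [shannonEntropy_eq_neg_sum_mass]
  linarith

theorem shannonEntropy_jointPMF (μ : PMF W) (κ : W → PMF M) :
    shannonEntropy (jointPMF μ κ) = shannonEntropy μ + ∑ w, mass μ w * shannonEntropy (κ w) := by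
  simp only [shannonEntropy_eq_neg_sum_mass, mass_jointPMF, Fintype.sum_prod_type, mul_neg,
    sum_neg_distrib, ← neg_add, ← sum_add_distrib]
  refine congrArg Neg.neg <| sum_congr rfl fun w _ => ?_
  calc ∑ m, mass μ w * mass (κ w) m * logb 2 (mass μ w * mass (κ w) m)
      = ∑ m, (mass μ w * logb 2 (mass μ w) * mass (κ w) m
          + mass μ w * (mass (κ w) m * logb 2 (mass (κ w) m))) := by
        refine sum_congr rfl fun m _ => ?_
        rcases eq_or_ne (mass μ w) 0 with hw | hw
        · simp [hw]
        rcases eq_or_ne (mass (κ w) m) 0 with hm | hm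
        · simp [hm]
        rw [logb_mul hw hm]
        ring
    _ = _ := by rw [sum_add_distrib, ← mul_sum, ← mul_sum, sum_mass, mul_one]

theorem mutualInfo_jointPMF (μ : PMF W) (κ : W → PMF M) :
    mutualInfo (jointPMF μ κ)
      = shannonEntropy (μ.bind κ) - ∑ w, mass μ w * shannonEntropy (κ w) := by
  rw [mutualInfo, map_fst_jointPMF, map_snd_jointPMF, shannonEntropy_jointPMF]
  ring

theorem mutualInfo_jointPMF_le_logb_card (μ : PMF W) (κ : W → PMF M) :
    mutualInfo (jointPMF μ κ) ≤ logb 2 (Fintype.card M) := by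
  rw [mutualInfo_jointPMF]
  have hcond : 0 ≤ ∑ w, mass μ w * shannonEntropy (κ w) :=
    sum_nonneg fun w _ => mul_nonneg (mass_nonneg μ w) (shannonEntropy_nonneg (κ w))
  linarith [shannonEntropy_le_logb_card (μ.bind κ)]

end Mass

section UniformInput

variable {M N V W ι : Type*} [Fintype V] [Fintype W] [Fintype ι] [DecidableEq ι]

theorem expect_prod_apply (g : ι → W → ℝ) :
    𝔼 x : ι → W, ∏ i, g i (x i) = ∏ i, 𝔼 w, g i w := by
  simp only [Fintype.expect_eq_sum_div_card, prod_div_distrib, Fintype.prod_sum, prod_const,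
    card_univ, Fintype.card_fun, Nat.cast_pow]

variable [Nonempty V] [Nonempty W]

theorem expect_expect_update (i : ι) (F : (ι → W) → W → ℝ) :
    𝔼 w, 𝔼 x, F (Function.update x i w) w = 𝔼 x, F x (x i) := by
  have hswap : Function.Involutive fun a : W × (ι → W) => (a.2 i, Function.update a.2 i a.1) :=
    fun a => by simp
  calc 𝔼 w, 𝔼 x, F (Function.update x i w) w
      = 𝔼 a : W × (ι → W), F (Function.update a.2 i a.1) a.1 :=
        (expect_product univ univ fun a : W × (ι → W) => F (Function.update a.2 i a.1) a.1).symm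
    _ = 𝔼 a : W × (ι → W), F a.2 (a.2 i) :=
        Fintype.expect_bijective _ hswap.bijective _ _ fun a => by simp
    _ = 𝔼 x, F x (x i) := by
        rw [← univ_product_univ, expect_product]
        exact Fintype.expect_const (ι := W) (𝔼 x, F x (x i))

/-- The distribution of the output of a channel `κ` with uniformly random input. -/
noncomputable def outputDist (κ : W → PMF M) : PMF M := (PMF.uniformOfFintype W).bind κ

theorem mass_uniformOfFintype (w : W) :
    mass (PMF.uniformOfFintype W) w = (Fintype.card W : ℝ)⁻¹ := by
  simp [mass]

theorem mass_outputDist (κ : W → PMF M) (m : M) :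
    mass (outputDist κ) m = 𝔼 w, mass (κ w) m := by
  simp only [outputDist, mass_bind, mass_uniformOfFintype, Fintype.expect_eq_sum_div_card,
    inv_mul_eq_div, sum_div]

theorem support_mass_subset_support_mass_outputDist (κ : W → PMF M) (w : W) :
    support (mass (κ w)) ⊆ support (mass (outputDist κ)) := by
  intro m hm hzero
  rw [mass_outputDist, expect_eq_zero_iff_of_nonneg fun w _ => mass_nonneg (κ w) m] at hzero
  exact hm (hzero w (mem_univ w))

/-- The channel that feeds its input into coordinate `i` of the many-input channel `κ` and fills
the remaining coordinates uniformly at random. -/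
noncomputable def coordChan (κ : (ι → W) → PMF M) (i : ι) (w : W) : PMF M :=
  outputDist fun x => κ (Function.update x i w)

theorem expect_mass_coordChan_mul (κ : (ι → W) → PMF M) (i : ι) (φ : W → ℝ) (m : M) :
    𝔼 w, mass (coordChan κ i w) m * φ w = 𝔼 x, mass (κ x) m * φ (x i) := by
  simp only [coordChan, mass_outputDist, expect_mul]
  exact expect_expect_update i fun x w => mass (κ x) m * φ w

theorem mass_outputDist_coordChan (κ : (ι → W) → PMF M) (i : ι) :
    mass (outputDist (coordChan κ i)) = mass (outputDist κ) := by
  funext m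
  simpa [mass_outputDist] using expect_mass_coordChan_mul κ i (fun _ => 1) m

theorem support_mass_subset_support_mass_coordChan (κ : (ι → W) → PMF M) (i : ι) (x : ι → W) :
    support (mass (κ x)) ⊆ support (mass (coordChan κ i (x i))) := by
  simpa only [coordChan, Function.update_eq_self] using
    support_mass_subset_support_mass_outputDist (fun z => κ (Function.update z i (x i))) x

variable [Fintype M] [Fintype N]

/-- The mutual information, in bits, between the uniformly random input of a channel and its
output: on average over the input, how far the output is from its overall distribution. -/
noncomputable def chanInfo (κ : W → PMF M) : ℝ :=
  𝔼 w, relEntropy (mass (κ w)) (mass (outputDist κ))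

theorem relEntropy_mass_outputDist_nonneg (κ : W → PMF M) (w : W) :
    0 ≤ relEntropy (mass (κ w)) (mass (outputDist κ)) :=
  relEntropy_nonneg (mass_nonneg _) (mass_nonneg _)
    (support_mass_subset_support_mass_outputDist κ w) (by rw [sum_mass, sum_mass])

theorem chanInfo_nonneg (κ : W → PMF M) : 0 ≤ chanInfo κ :=
  expect_nonneg fun w _ => relEntropy_mass_outputDist_nonneg κ w

theorem mutualInfo_jointPMF_uniformOfFintype (κ : W → PMF M) :
    mutualInfo (jointPMF (PMF.uniformOfFintype W) κ) = chanInfo κ := by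
  have hterm (w : W) : relEntropy (mass (κ w)) (mass (outputDist κ))
      = -shannonEntropy (κ w) - ∑ m, mass (κ w) m * logb 2 (mass (outputDist κ) m) := by
    rw [relEntropy_eq_sub (support_mass_subset_support_mass_outputDist κ w),
      shannonEntropy_eq_neg_sum_mass, neg_neg]
  rw [mutualInfo_jointPMF, chanInfo, ← outputDist, shannonEntropy_eq_neg_sum_mass (outputDist κ)]
  simp only [hterm, expect_sub_distrib, expect_neg_distrib, expect_sum_comm, ← expect_mul,
    ← mass_outputDist]
  rw [Fintype.expect_eq_sum_div_card]
  simp only [mass_uniformOfFintype, ← mul_sum]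
  ring

theorem chanInfo_prod (κ : V → PMF M) (η : W → PMF N) :
    chanInfo (fun x : V × W => jointPMF (κ x.1) fun _ => η x.2) = chanInfo κ + chanInfo η := by
  have hmass (x : V × W) : mass (jointPMF (κ x.1) fun _ => η x.2)
      = fun m => mass (κ x.1) m.1 * mass (η x.2) m.2 := funext (mass_jointPMF _ _)
  have hout : mass (outputDist fun x : V × W => jointPMF (κ x.1) fun _ => η x.2)
      = fun m => mass (outputDist κ) m.1 * mass (outputDist η) m.2 := by
    funext m
    simp only [mass_outputDist, hmass]
    rw [← univ_product_univ, expect_product, expect_mul_expect]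
  have hrel (x : V × W) : relEntropy (fun m : M × N => mass (κ x.1) m.1 * mass (η x.2) m.2)
      (fun m => mass (outputDist κ) m.1 * mass (outputDist η) m.2)
      = relEntropy (mass (κ x.1)) (mass (outputDist κ))
        + relEntropy (mass (η x.2)) (mass (outputDist η)) := by
    rw [relEntropy_mul_mul (support_mass_subset_support_mass_outputDist κ x.1)
      (support_mass_subset_support_mass_outputDist η x.2), sum_mass, sum_mass, mul_one, one_mul]
  simp only [chanInfo, hmass, hout, hrel]
  rw [← univ_product_univ, expect_product]
  simp only [expect_add_distrib, Fintype.expect_const]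

theorem chanInfo_coordChan (κ : (ι → W) → PMF M) (i : ι) :
    chanInfo (coordChan κ i) = 𝔼 x, ∑ m, mass (κ x) m
      * logb 2 (mass (coordChan κ i (x i)) m / mass (outputDist κ) m) := by
  simp only [chanInfo, relEntropy, mass_outputDist_coordChan, expect_sum_comm]
  exact sum_congr rfl fun m _ => expect_mass_coordChan_mul κ i
    (fun w => logb 2 (mass (coordChan κ i w) m / mass (outputDist κ) m)) m

theorem expect_sum_mass_mul_prod_coordChan_le_one (κ : (ι → W) → PMF M) :
    𝔼 x : ι → W, ∑ m, mass (outputDist κ) m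
      * ∏ i, mass (coordChan κ i (x i)) m / mass (outputDist κ) m ≤ 1 := by
  rw [expect_sum_comm, ← sum_mass (outputDist κ)]
  refine sum_le_sum fun m _ => ?_
  rw [← mul_expect, expect_prod_apply fun i w => mass (coordChan κ i w) m / mass (outputDist κ) m]
  refine mul_le_of_le_one_right (mass_nonneg _ m) (prod_le_one (fun i _ => ?_) fun i _ => ?_)
  · exact expect_nonneg fun w _ => div_nonneg (mass_nonneg _ m) (mass_nonneg _ m)
  · rw [← expect_div, ← mass_outputDist, mass_outputDist_coordChan]
    exact div_self_le_one _

theorem sum_chanInfo_coordChan_le (κ : (ι → W) → PMF M) :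
    ∑ i, chanInfo (coordChan κ i) ≤ chanInfo κ := by
  -- Compare the law of the message on input `x` with `r x`, which treats the coordinates of a
  -- uniform input as independent given the message.
  let r (x : ι → W) (m : M) : ℝ :=
    mass (outputDist κ) m * ∏ i, mass (coordChan κ i (x i)) m / mass (outputDist κ) m
  have hgibbs (x : ι → W) : (1 - ∑ m, r x m) / log 2
      ≤ relEntropy (mass (κ x)) (mass (outputDist κ)) - ∑ i, ∑ m, mass (κ x) m
        * logb 2 (mass (coordChan κ i (x i)) m / mass (outputDist κ) m) := by
    have hout := support_mass_subset_support_mass_outputDist κ x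
    have hcoord (i : ι) := support_mass_subset_support_mass_coordChan κ i x
    rw [← relEntropy_mul_prod_div hout hcoord, ← sum_mass (κ x)]
    refine sum_sub_sum_div_log_two_le_relEntropy (mass_nonneg _) (fun m => ?_) fun m hm => ?_
    · exact mul_nonneg (mass_nonneg _ m)
        (prod_nonneg fun i _ => div_nonneg (mass_nonneg _ m) (mass_nonneg _ m))
    · exact mul_ne_zero (hout hm)
        (prod_ne_zero_iff.2 fun i _ => div_ne_zero (hcoord i hm) (hout hm))
  have hdefect : 0 ≤ 𝔼 x, (1 - ∑ m, r x m) / log 2 := by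
    rw [← expect_div, expect_sub_distrib, Fintype.expect_const]
    exact div_nonneg (sub_nonneg.2 (expect_sum_mass_mul_prod_coordChan_le_one κ))
      (log_pos one_lt_two).le
  have haverage := hdefect.trans (expect_le_expect fun x _ => hgibbs x)
  rw [expect_sub_distrib, expect_sum_comm] at haverage
  simp only [chanInfo_coordChan]
  exact sub_nonneg.1 haverage

end UniformInput

section Compression

variable {M I S T W : Type*}

section RandomSamples

variable [Fintype M] [Fintype I]

theorem sum_mass_mul_exp_mul_mul_le (q : PMF M) {w y : M → ℝ} (hw : ∀ m, w m ∈ Set.Icc 0 1)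
    (hy : ∀ m, |y m| ≤ 1) {c : ℝ} (hc : c ∈ Set.Icc 0 1) :
    ∑ m, mass q m * exp (c * (w m * y m))
      ≤ exp (c * ∑ m, mass q m * w m * y m + c ^ 2 * ∑ m, mass q m * w m) := by
  have hexp (m : M) : exp (c * (w m * y m)) ≤ 1 + c * (w m * y m) + c ^ 2 * w m := by
    have hwy : |w m * y m| ≤ 1 := by
      rw [abs_mul, abs_of_nonneg (hw m).1]
      exact mul_le_one₀ (hw m).2 (abs_nonneg _) (hy m)
    have hle : |c * (w m * y m)| ≤ 1 := by
      rw [abs_mul, abs_of_nonneg hc.1]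
      exact mul_le_one₀ hc.2 (abs_nonneg _) hwy
    have hsq : (w m * y m) ^ 2 ≤ w m := by
      have hw2 : w m ^ 2 ≤ w m := pow_le_of_le_one (hw m).1 (hw m).2 two_ne_zero
      have hy2 : y m ^ 2 ≤ 1 := (sq_le_one_iff_abs_le_one _).2 (hy m)
      calc (w m * y m) ^ 2 = w m ^ 2 * y m ^ 2 := mul_pow _ _ _
        _ ≤ w m * 1 := by gcongr; exact (hw m).1
        _ = w m := mul_one _
    have hquad := (abs_le.1 (abs_exp_sub_one_sub_id_le hle)).2
    rw [mul_pow] at hquad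
    linarith [mul_le_mul_of_nonneg_left hsq (sq_nonneg c)]
  calc ∑ m, mass q m * exp (c * (w m * y m))
      ≤ ∑ m, mass q m * (1 + c * (w m * y m) + c ^ 2 * w m) :=
        sum_le_sum fun m _ => mul_le_mul_of_nonneg_left (hexp m) (mass_nonneg q m)
    _ = ∑ m, (c * (mass q m * w m * y m) + c ^ 2 * (mass q m * w m) + mass q m) :=
        sum_congr rfl fun m _ => by ring
    _ = c * ∑ m, mass q m * w m * y m + c ^ 2 * ∑ m, mass q m * w m + 1 := by
        rw [sum_add_distrib, sum_add_distrib, ← mul_sum, ← mul_sum, sum_mass]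
    _ ≤ _ := add_one_le_exp _

theorem exists_forall_sum_neg (q : PMF M) {G : Finset T} {Z : T → M → ℝ} {θ : ℝ}
    (hZ : ∀ t ∈ G, ∑ m, mass q m * exp (Z t m) ≤ exp (-θ))
    (hG : (#G : ℝ) < exp (Fintype.card I * θ)) :
    ∃ s : I → M, ∀ t ∈ G, ∑ i, Z t (s i) < 0 := by
  classical
  by_contra! hbad
  have hpow (F : M → ℝ) : ∑ s : I → M, ∏ i, F (s i) = (∑ m, F m) ^ Fintype.card I := by
    rw [← Fintype.prod_sum fun (_ : I) m => F m, prod_const, card_univ]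
  have hterm (t : T) (s : I → M) : 0 ≤ ∏ i, mass q (s i) * exp (Z t (s i)) :=
    prod_nonneg fun i _ => mul_nonneg (mass_nonneg q _) (exp_pos _).le
  have hcover (s : I → M) :
      ∏ i, mass q (s i) ≤ ∑ t ∈ G, ∏ i, mass q (s i) * exp (Z t (s i)) := by
    obtain ⟨t, ht, hst⟩ := hbad s
    refine le_trans ?_ (single_le_sum (fun t _ => hterm t s) ht)
    rw [prod_mul_distrib, ← exp_sum]
    exact le_mul_of_one_le_right (prod_nonneg fun i _ => mass_nonneg q _) (one_le_exp hst)
  have hunion : (1 : ℝ) ≤ #G * exp (-(Fintype.card I * θ)) :=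
    calc (1 : ℝ) = ∑ s : I → M, ∏ i, mass q (s i) := by rw [hpow, sum_mass, one_pow]
      _ ≤ ∑ s : I → M, ∑ t ∈ G, ∏ i, mass q (s i) * exp (Z t (s i)) :=
          sum_le_sum fun s _ => hcover s
      _ = ∑ t ∈ G, (∑ m, mass q m * exp (Z t m)) ^ Fintype.card I := by
          rw [sum_comm]
          exact sum_congr rfl fun t _ => hpow fun m => mass q m * exp (Z t m)
      _ ≤ ∑ _t ∈ G, exp (-θ) ^ Fintype.card I := by
          refine sum_le_sum fun t ht => pow_le_pow_left₀ (sum_nonneg fun m _ => ?_) (hZ t ht) _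
          exact mul_nonneg (mass_nonneg q m) (exp_pos _).le
      _ = #G * exp (-(Fintype.card I * θ)) := by
          rw [sum_const, nsmul_eq_mul, ← exp_nat_mul, mul_neg]
  rw [exp_neg, ← div_eq_mul_inv, one_le_div (exp_pos _)] at hunion
  exact hG.not_ge hunion

theorem exists_pmf_sum_mass_mul_lt [Nonempty I] {w : I → ℝ} (hw : ∀ i, 0 ≤ w i) :
    ∃ r : PMF I, ∀ (h : I → ℝ) (c : ℝ), ∑ i, w i * (h i - c) < 0 → ∑ i, mass r i * h i < c := by
  rcases (sum_nonneg fun i (_ : i ∈ univ) => hw i).eq_or_lt with hsum | hsum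
  · refine ⟨PMF.pure (Classical.arbitrary I), fun h c hneg => ?_⟩
    have hzero := (sum_eq_zero_iff_of_nonneg fun i _ => hw i).1 hsum.symm
    exact absurd hneg (sum_eq_zero fun i hi => by rw [hzero i hi, zero_mul]).not_lt
  · have hdiv (i : I) : 0 ≤ w i / ∑ j, w j := div_nonneg (hw i) hsum.le
    refine ⟨PMF.ofFintype (fun i => ENNReal.ofReal (w i / ∑ j, w j)) ?_, fun h c hneg => ?_⟩
    · rw [← ENNReal.ofReal_sum_of_nonneg fun i _ => hdiv i, ← sum_div, div_self hsum.ne',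
        ENNReal.ofReal_one]
    · simp only [mass, PMF.ofFintype_apply, ENNReal.toReal_ofReal (hdiv _), div_mul_eq_mul_div]
      rw [← sum_div, div_lt_iff₀ hsum, mul_comm, sum_mul]
      simpa only [mul_sub, sum_sub_distrib, sub_neg] using hneg

end RandomSamples

section RejectionSampling

variable {p q : PMF M} {K ε : ℝ}

open Classical in
/-- The probability of accepting a `q`-random `m` in rejection sampling from `p`, when the
likelihood ratio is truncated at `K`: the accepted `m` follows `p` conditioned on the event that
`p m ≤ K * q m`. -/
noncomputable def acceptProb (p q : PMF M) (K : ℝ) (m : M) : ℝ :=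
  if K * mass q m < mass p m then 0 else mass p m / (K * mass q m)

theorem acceptProb_mem_Icc (hK : 0 < K) (m : M) : acceptProb p q K m ∈ Set.Icc 0 1 := by
  have hKq : 0 ≤ K * mass q m := mul_nonneg hK.le (mass_nonneg q m)
  rw [acceptProb]
  split_ifs with h
  · simp
  · exact ⟨div_nonneg (mass_nonneg p m) hKq, div_le_one_of_le₀ (not_lt.1 h) hKq⟩

open Classical in
theorem mass_mul_acceptProb (hK : 0 < K) (m : M) :
    mass q m * acceptProb p q K m = (if K * mass q m < mass p m then 0 else mass p m) / K := by
  rw [acceptProb]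
  split_ifs with h
  · simp
  rcases eq_or_ne (mass q m) 0 with hq | hq
  · have hp : mass p m = 0 := le_antisymm (by simpa [hq] using h) (mass_nonneg p m)
    simp [hq, hp]
  · field_simp

variable [Fintype M]

theorem sum_mass_mul_acceptProb (hK : 0 < K) :
    ∑ m, mass q m * acceptProb p q K m
      = (1 - ∑ m with K * mass q m < mass p m, mass p m) / K := by
  classical
  simp only [mass_mul_acceptProb hK, ← sum_div, ← sum_mass p, sum_filter, ← sum_sub_distrib]
  congr! 2 with m
  split_ifs <;> simp

theorem sum_mass_mul_acceptProb_mul_le (hK : 0 < K) {h : M → ℝ} (hh : ∀ m, 0 ≤ h m) :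
    ∑ m, mass q m * acceptProb p q K m * h m ≤ (∑ m, mass p m * h m) / K := by
  classical
  rw [sum_div]
  refine sum_le_sum fun m _ => ?_
  rw [mass_mul_acceptProb hK, mul_div_right_comm]
  have := hh m
  gcongr
  split_ifs
  exacts [mass_nonneg p m, le_rfl]

theorem sum_mass_mul_exp_acceptProb_le {h : M → ℝ} (hh : ∀ m, h m ∈ Set.Icc 0 1) (hK : 0 < K)
    (hε : 0 < ε) (htail : ∑ m with K * mass q m < mass p m, mass p m ≤ ε)
    (hc : ∑ m, mass p m * h m + 2 * ε ≤ 1) :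
    ∑ m, mass q m
        * exp (ε / 2 * (acceptProb p q K m * (h m - (∑ m, mass p m * h m + 2 * ε))))
      ≤ exp (-((1 - ε) * ε ^ 2 / (4 * K))) := by
  set a := ∑ m, mass p m * h m
  set ρ := ∑ m, mass q m * acceptProb p q K m with hρ
  have ha : 0 ≤ a := (sum_mass_mul_mem_Icc p hh).1
  have hy (m : M) : |h m - (a + 2 * ε)| ≤ 1 :=
    abs_le.2 ⟨by linarith [(hh m).1], by linarith [(hh m).2]⟩
  have hρε : (1 - ε) / K ≤ ρ := by
    rw [hρ, sum_mass_mul_acceptProb hK]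
    gcongr
  have hmean : ∑ m, mass q m * acceptProb p q K m * (h m - (a + 2 * ε)) ≤ -(ε * ρ) := by
    have htest := sum_mass_mul_acceptProb_mul_le (p := p) (q := q) hK fun m => (hh m).1
    have hgap : a / K ≤ (a + ε) * ρ :=
      calc a / K ≤ (a + ε) * ((1 - ε) / K) := by
            rw [← mul_div_assoc]
            gcongr
            nlinarith
        _ ≤ (a + ε) * ρ := by gcongr
    simp only [mul_sub, sum_sub_distrib, ← sum_mul, ← hρ]
    linarith
  refine (sum_mass_mul_exp_mul_mul_le q (acceptProb_mem_Icc hK) hy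
    ⟨by linarith, by linarith⟩).trans (exp_le_exp.2 ?_)
  calc ε / 2 * ∑ m, mass q m * acceptProb p q K m * (h m - (a + 2 * ε)) + (ε / 2) ^ 2 * ρ
      ≤ ε / 2 * (-(ε * ρ)) + (ε / 2) ^ 2 * ρ := by gcongr
    _ = -(ε ^ 2 / 4 * ρ) := by ring
    _ ≤ -(ε ^ 2 / 4 * ((1 - ε) / K)) := by gcongr
    _ = -((1 - ε) * ε ^ 2 / (4 * K)) := by field_simp

theorem exists_compression [Fintype I] [Nonempty I] [Fintype S] [Fintype T] {p : S → PMF M}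
    {h : S → T → M → ℝ} (hh : ∀ x t m, h x t m ∈ Set.Icc 0 1) (hK : 0 < K) (hε : 0 < ε)
    (htail : ∀ x, ∑ m with K * mass q m < mass (p x) m, mass (p x) m ≤ ε)
    (hI : (Fintype.card S * Fintype.card T : ℝ)
      < exp (Fintype.card I * ((1 - ε) * ε ^ 2 / (4 * K)))) :
    ∃ (s : I → M) (r : S → PMF I), ∀ x t,
      ∑ i, mass (r x) i * h x t (s i) ≤ ∑ m, mass (p x) m * h x t m + 2 * ε := by
  classical
  let c (a : S × T) : ℝ := ∑ m, mass (p a.1) m * h a.1 a.2 m + 2 * ε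
  let G : Finset (S × T) := {a | c a ≤ 1}
  have hG : (#G : ℝ) ≤ Fintype.card S * Fintype.card T := by
    exact_mod_cast (card_le_univ G).trans (Fintype.card_prod S T).le
  obtain ⟨s, hs⟩ := exists_forall_sum_neg q
    (Z := fun a m => ε / 2 * (acceptProb (p a.1) q K m * (h a.1 a.2 m - c a)))
    (fun a ha => sum_mass_mul_exp_acceptProb_le (hh a.1 a.2) hK hε (htail a.1)
      (mem_filter.1 ha).2) (hG.trans_lt hI)
  choose r hr using fun x => exists_pmf_sum_mass_mul_lt
    fun i => (acceptProb_mem_Icc (p := p x) (q := q) hK (s i)).1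
  refine ⟨s, r, fun x t => ?_⟩
  rcases le_or_gt (c (x, t)) 1 with hc | hc
  · refine (hr x _ _ ?_).le
    have hneg := hs (x, t) (mem_filter.2 ⟨mem_univ _, hc⟩)
    rw [← mul_sum] at hneg
    exact neg_of_mul_neg_right hneg (half_pos hε).le
  · exact (sum_mass_mul_mem_Icc (r x) fun i => hh x t (s i)).2.trans hc.le

end RejectionSampling

theorem two_thirds_mul_card_le_card_filter_le_three_mul_expect [Fintype W] {F : W → ℝ}
    (hF : ∀ w, 0 ≤ F w) :
    (2 / 3 : ℝ) * Fintype.card W ≤ #{w | F w ≤ 3 * 𝔼 w, F w} := by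
  set E := 𝔼 w, F w
  set bad : Finset W := {w | ¬F w ≤ 3 * E}
  by_contra! hlt
  have hcard : (Fintype.card W : ℝ) < 3 * #bad := by
    have hsplit := congrArg (Nat.cast (R := ℝ))
      (card_filter_add_card_filter_not (s := univ) fun w => F w ≤ 3 * E)
    rw [card_univ, Nat.cast_add] at hsplit
    linarith
  have hbad : bad.Nonempty := by
    rw [← card_pos, ← Nat.cast_pos (α := ℝ)]
    linarith [(Fintype.card W).cast_nonneg (α := ℝ)]
  have hE : 0 ≤ E := expect_nonneg fun w _ => hF w
  have hsum := calc #bad * (3 * E)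
      = ∑ w ∈ bad, 3 * E := by rw [sum_const, nsmul_eq_mul]
    _ < ∑ w ∈ bad, F w := sum_lt_sum_of_nonempty hbad fun w hw => not_le.1 (mem_filter.1 hw).2
    _ ≤ ∑ w, F w := sum_le_univ_sum_of_nonneg hF
    _ = Fintype.card W * E := (Fintype.card_mul_expect F).symm
  nlinarith

theorem exists_message_length {ν b ε : ℝ} (hν : 0 ≤ ν) (hb : 0 ≤ b) (hε : 0 < ε) (hε1 : ε < 1) :
    ∃ l : ℕ, (4 : ℝ) ^ ν < exp (2 ^ l * ((1 - ε) * ε ^ 2 / (4 * 2 ^ b))) ∧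
      l ≤ b + logb 2 (ν + 1) + logb 2 (1 / (ε ^ 2 * (1 - ε))) + 4 := by
  have hε' : 0 < 1 - ε := sub_pos.2 hε1
  have hε2 : ε ^ 2 * (1 - ε) ≤ 1 := mul_le_one₀ (pow_le_one₀ hε.le hε1.le) hε'.le (by linarith)
  set c := ε ^ 2 * (1 - ε) with hc
  have hc0 : 0 < c := by positivity
  have hlog : logb 2 (8 * (ν + 1) * 2 ^ b / c) = b + logb 2 (ν + 1) + logb 2 (1 / c) + 3 := by
    have h8 : logb 2 8 = 3 := by
      rw [show (8 : ℝ) = 2 ^ (3 : ℝ) by norm_num, logb_rpow two_pos (by norm_num)]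
    rw [div_eq_mul_one_div, logb_mul (by positivity) (by positivity),
      logb_mul (by positivity) (by positivity), logb_mul (by positivity) (by positivity), h8,
      logb_rpow two_pos (by norm_num)]
    ring
  refine ⟨⌈logb 2 (8 * (ν + 1) * 2 ^ b / c)⌉₊, ?_, ?_⟩
  · set l := ⌈logb 2 (8 * (ν + 1) * 2 ^ b / c)⌉₊
    have hl : 8 * (ν + 1) * 2 ^ b / c ≤ 2 ^ l := by
      rw [← rpow_natCast, ← logb_le_iff_le_rpow one_lt_two (by positivity)]
      exact Nat.le_ceil _
    have h4 : (4 : ℝ) < exp 2 :=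
      calc (4 : ℝ) < exp 1 * exp 1 := by nlinarith [exp_one_gt_d9]
        _ = exp 2 := by rw [← exp_add, one_add_one_eq_two]
    calc (4 : ℝ) ^ ν ≤ exp 2 ^ ν := by gcongr
      _ = exp (2 * ν) := (exp_mul 2 ν).symm
      _ < exp (8 * (ν + 1) * 2 ^ b / c * ((1 - ε) * ε ^ 2 / (4 * 2 ^ b))) := by
          rw [exp_lt_exp, mul_comm (1 - ε), ← hc]
          field_simp
          linarith
      _ ≤ exp (2 ^ l * ((1 - ε) * ε ^ 2 / (4 * 2 ^ b))) := by gcongr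
  · have hν1 : 0 ≤ logb 2 (ν + 1) := logb_nonneg one_lt_two (by linarith)
    have hc1 : 0 ≤ logb 2 (1 / c) := logb_nonneg one_lt_two ((one_le_div hc0).2 hε2)
    rw [hlog]
    exact (Nat.ceil_lt_add_one (by positivity)).le.trans (by linarith)

end Compression

namespace SimProtocol

variable {X Y Z ι : Type*}

theorem mass_transcript (P : SimProtocol X Y Z) (x : X) (y : Y)
    (t : (Fin P.lenA → Bool) × (Fin P.lenB → Bool)) :
    mass (P.transcript x y) t = mass (P.alice x) t.1 * mass (P.bob y) t.2 :=
  mass_jointPMF (P.alice x) (fun _ => P.bob y) t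

open Classical in
/-- The probability, over the coin tosses of Alice and Bob, that the referee does not announce `z`
on input `(x, y)`. It is written as Alice's average of Bob's average, so that the message
distribution of one player can be exchanged while the other's is held fixed. -/
noncomputable def errorProb (P : SimProtocol X Y Z) (x : X) (y : Y) (z : Z) : ℝ :=
  ∑ u, mass (P.alice x) u * ∑ v, mass (P.bob y) v * if P.referee u v = z then 0 else 1

theorem probOutput_add_errorProb (P : SimProtocol X Y Z) (x : X) (y : Y) (z : Z) :
    P.probOutput x y z + P.errorProb x y z = 1 := by
  classical
  rw [← sum_mass (P.transcript x y), probOutput, errorProb]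
  simp only [mul_sum, ← Fintype.sum_prod_type', ← sum_add_distrib]
  refine sum_congr rfl fun t _ => ?_
  change (if P.referee t.1 t.2 = z then mass (P.transcript x y) t else 0) + _ = _
  rw [mass_transcript]
  split_ifs <;> simp

theorem computes_iff {P : SimProtocol X Y Z} {f : X → Y → Z} {δ : ℝ} :
    P.Computes f δ ↔ ∀ x y, P.errorProb x y (f x y) ≤ δ := by
  refine forall₂_congr fun x y => ?_
  rw [← P.probOutput_add_errorProb x y (f x y), sub_le_iff_le_add]
  exact add_le_add_iff_left _

/-- The protocol with the roles of Alice and Bob exchanged. -/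
def swap (P : SimProtocol X Y Z) : SimProtocol Y X Z where
  lenA := P.lenB
  lenB := P.lenA
  alice := P.bob
  bob := P.alice
  referee u v := P.referee v u

theorem errorProb_swap (P : SimProtocol X Y Z) (x : X) (y : Y) (z : Z) :
    P.swap.errorProb y x z = P.errorProb x y z := by
  simp only [errorProb, mul_sum]
  rw [sum_comm]
  exact sum_congr rfl fun u _ => sum_congr rfl fun v _ => mul_left_comm _ _ _

theorem Computes.swap {P : SimProtocol X Y Z} {f : X → Y → Z} {δ : ℝ} (hP : P.Computes f δ) :
    P.swap.Computes (fun y x => f x y) δ :=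
  computes_iff.2 fun y x => (P.errorProb_swap x y _).trans_le (computes_iff.1 hP x y)

theorem Rsim_le_cost {P : SimProtocol X Y Z} {f : X → Y → Z} {δ : ℝ} (hP : P.Computes f δ) :
    Rsim δ f ≤ P.cost :=
  Nat.sInf_le ⟨P, hP, rfl⟩

theorem exists_injective_bitString (α : Type*) [Finite α] :
    ∃ (l : ℕ) (e : α → Fin l → Bool), e.Injective := by
  obtain ⟨l, ⟨e⟩⟩ := Finite.exists_equiv_fin α
  refine ⟨l, fun a i => decide (e a = i), fun a b hab => e.injective ?_⟩
  simpa using congrFun hab (e b)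

section Existence

variable [Finite X] [Finite Y] [Nonempty X] [Nonempty Y]

theorem exists_computes (f : X → Y → Z) {δ : ℝ} (hδ : 0 ≤ δ) :
    ∃ P : SimProtocol X Y Z, P.Computes f δ := by
  classical
  obtain ⟨a, e, he⟩ := exists_injective_bitString X
  obtain ⟨b, e', he'⟩ := exists_injective_bitString Y
  refine ⟨⟨a, b, fun x => PMF.pure (e x), fun y => PMF.pure (e' y),
    fun u v => f (e.invFun u) (e'.invFun v)⟩, computes_iff.2 fun x y => ?_⟩
  simpa only [errorProb, mass_pure, ite_mul, one_mul, zero_mul, sum_ite_eq', mem_univ, if_true,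
    Function.leftInverse_invFun he x, Function.leftInverse_invFun he' y] using hδ

theorem exists_computes_cost_eq_Rsim (f : X → Y → Z) {δ : ℝ} (hδ : 0 ≤ δ) :
    ∃ P : SimProtocol X Y Z, P.Computes f δ ∧ P.cost = Rsim δ f := by
  obtain ⟨P, hP⟩ := exists_computes f hδ
  exact Nat.sInf_mem (s := {c | ∃ P : SimProtocol X Y Z, P.Computes f δ ∧ P.cost = c})
    ⟨P.cost, P, hP, rfl⟩

end Existence

section InformationCost

variable [Fintype X] [Fintype Y]

theorem infoCost_le_cost (P : SimProtocol X Y Z) (μ : PMF (X × Y)) : P.infoCost μ ≤ P.cost := by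
  refine (mutualInfo_jointPMF_le_logb_card μ fun xy => P.transcript xy.1 xy.2).trans_eq ?_
  simp [cost, ← pow_add, logb_pow]

variable [Nonempty X] [Nonempty Y]

theorem infoCost_uniformOfFintype (P : SimProtocol X Y Z) :
    P.infoCost (PMF.uniformOfFintype (X × Y)) = chanInfo P.alice + chanInfo P.bob :=
  (mutualInfo_jointPMF_uniformOfFintype _).trans (chanInfo_prod P.alice P.bob)

theorem ICsim_le_infoCost {P : SimProtocol X Y Z} {f : X → Y → Z} {δ : ℝ} (hP : P.Computes f δ) :
    ICsim δ f ≤ P.infoCost (PMF.uniformOfFintype (X × Y)) := by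
  refine csInf_le ⟨0, ?_⟩ ⟨P, hP, rfl⟩
  rintro _ ⟨Q, -, rfl⟩
  rw [infoCost_uniformOfFintype]
  exact add_nonneg (chanInfo_nonneg _) (chanInfo_nonneg _)

end InformationCost

section DirectSum

variable [Fintype X] [Nonempty X] [Fintype Y] [Nonempty Y] [Fintype ι] [DecidableEq ι]

/-- The protocol for a single input pair obtained from one for many: both players put their input
in coordinate `i` and fill the other coordinates uniformly at random with private coins; the
referee announces coordinate `i` of the answer. -/
noncomputable def coord (P : SimProtocol (ι → X) (ι → Y) (ι → Z)) (i : ι) : SimProtocol X Y Z where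
  lenA := P.lenA
  lenB := P.lenB
  alice := coordChan P.alice i
  bob := coordChan P.bob i
  referee u v := P.referee u v i

theorem Computes.coord {P : SimProtocol (ι → X) (ι → Y) (ι → Z)} {f : X → Y → Z} {δ : ℝ}
    (hP : P.Computes (fun x y i => f (x i) (y i)) δ) (i : ι) : (P.coord i).Computes f δ := by
  classical
  refine computes_iff.2 fun x y => ?_
  calc (P.coord i).errorProb x y (f x y)
      = 𝔼 b, 𝔼 a, ∑ u, mass (P.alice (Function.update a i x)) u *
          ∑ v, mass (P.bob (Function.update b i y)) v *
            if P.referee u v i = f x y then 0 else 1 := by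
        simp only [errorProb, SimProtocol.coord, coordChan, mass_outputDist, expect_mul,
          ← expect_sum_comm, mul_expect]
        rfl
    _ ≤ 𝔼 _b : ι → Y, 𝔼 _a : ι → X, δ := by
        refine expect_le_expect fun b _ => expect_le_expect fun a _ => ?_
        refine le_trans ?_
          (computes_iff.1 hP (Function.update a i x) (Function.update b i y))
        refine sum_le_sum fun u _ => mul_le_mul_of_nonneg_left ?_ (mass_nonneg _ u)
        refine sum_le_sum fun v _ => mul_le_mul_of_nonneg_left ?_ (mass_nonneg _ v)
        split_ifs with hcoord hall hall
        · exact le_rfl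
        · exact zero_le_one
        · exact absurd (by simp [hall]) hcoord
        · exact le_rfl
    _ = δ := by simp only [Fintype.expect_const]

theorem sum_infoCost_coord_le (P : SimProtocol (ι → X) (ι → Y) (ι → Z)) :
    ∑ i, (P.coord i).infoCost (PMF.uniformOfFintype (X × Y))
      ≤ P.infoCost (PMF.uniformOfFintype ((ι → X) × (ι → Y))) := by
  simp only [infoCost_uniformOfFintype, sum_add_distrib]
  exact add_le_add (sum_chanInfo_coordChan_le P.alice) (sum_chanInfo_coordChan_le P.bob)

theorem mul_ICsim_le_Rsim_directSumFun (f : X → Y → Z) {δ : ℝ} (hδ : 0 ≤ δ) (m : ℕ) :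
    m * ICsim δ f ≤ Rsim δ (directSumFun m f) := by
  obtain ⟨P, hP, hcost⟩ := exists_computes_cost_eq_Rsim (directSumFun m f) hδ
  calc m * ICsim δ f
      = ∑ _i : Fin m, ICsim δ f := by simp
    _ ≤ ∑ i, (P.coord i).infoCost (PMF.uniformOfFintype (X × Y)) :=
        sum_le_sum fun i _ => ICsim_le_infoCost (hP.coord i)
    _ ≤ P.infoCost (PMF.uniformOfFintype ((Fin m → X) × (Fin m → Y))) := P.sum_infoCost_coord_le
    _ ≤ P.cost := P.infoCost_le_cost _
    _ = Rsim δ (directSumFun m f) := by rw [hcost]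

end DirectSum

section Compression

variable [Fintype X] [Nonempty X] [Fintype Y] {f : X → Y → Z} {δ ε ν : ℝ}

theorem Computes.exists_compress_alice {P : SimProtocol X Y Z} (hP : P.Computes f δ)
    (hcard : (Fintype.card X * Fintype.card Y : ℝ) ≤ 4 ^ ν) (hν : 0 ≤ ν) (hε : 0 < ε)
    (hε1 : ε < 1) :
    ∃ (A : Finset X) (l : ℕ) (alice : A → PMF (Fin l → Bool))
      (referee : (Fin l → Bool) → (Fin P.lenB → Bool) → Z),
      (2 / 3 : ℝ) * Fintype.card X ≤ #A ∧
      (mk l P.lenB alice P.bob referee).Computes (fun x y => f x y) (δ + 2 * ε) ∧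
      l ≤ (3 * chanInfo P.alice + 1) / ε + logb 2 (ν + 1) + logb 2 (1 / (ε ^ 2 * (1 - ε))) + 4 := by
  classical
  have hinfo := chanInfo_nonneg P.alice
  let A : Finset X :=
    {x | relEntropy (mass (P.alice x)) (mass (outputDist P.alice)) ≤ 3 * chanInfo P.alice}
  obtain ⟨l, hl, hlen⟩ := exists_message_length (b := (3 * chanInfo P.alice + 1) / ε) hν
    (by positivity) hε hε1
  have htail (x : A) := sum_filter_rpow_mul_lt_le_of_relEntropy_le (mass_nonneg (P.alice x))
    (mass_nonneg (outputDist P.alice)) (support_mass_subset_support_mass_outputDist P.alice x)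
    (sum_mass _).le (by positivity) (mem_filter.1 x.2).2 hε
  have hsize : (Fintype.card A * Fintype.card Y : ℝ)
      < exp (Fintype.card (Fin l → Bool)
        * ((1 - ε) * ε ^ 2 / (4 * 2 ^ ((3 * chanInfo P.alice + 1) / ε)))) := by
    have hA : Fintype.card A ≤ Fintype.card X := Fintype.card_subtype_le _
    calc (Fintype.card A * Fintype.card Y : ℝ) ≤ Fintype.card X * Fintype.card Y := by gcongr
      _ ≤ 4 ^ ν := hcard
      _ < _ := by simpa using hl
  obtain ⟨s, r, hsr⟩ := exists_compression (p := fun x : A => P.alice x) (q := outputDist P.alice)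
    (h := fun x y u => ∑ v, mass (P.bob y) v * if P.referee u v = f x y then 0 else 1)
    (fun x y u => sum_mass_mul_mem_Icc (P.bob y) fun v => by split_ifs <;> simp)
    (by positivity) hε htail hsize
  refine ⟨A, l, r, fun i v => P.referee (s i) v,
    two_thirds_mul_card_le_card_filter_le_three_mul_expect
      (relEntropy_mass_outputDist_nonneg P.alice), computes_iff.2 fun x y => ?_, hlen⟩
  exact (hsr x y).trans (by gcongr; exact computes_iff.1 hP x y)

theorem Computes.exists_compress [Nonempty Y] {P : SimProtocol X Y Z} (hP : P.Computes f δ)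
    (hcard : (Fintype.card X * Fintype.card Y : ℝ) ≤ 4 ^ ν) (hν : 0 ≤ ν) (hε : 0 < ε)
    (hε1 : ε < 1) :
    ∃ (A : Finset X) (B : Finset Y) (Q : SimProtocol A B Z),
      (2 / 3 : ℝ) * Fintype.card X ≤ #A ∧ (2 / 3 : ℝ) * Fintype.card Y ≤ #B ∧
      Q.Computes (restrictRect f A B) (δ + 4 * ε) ∧
      Q.cost ≤ 3 / ε * P.infoCost (PMF.uniformOfFintype (X × Y)) + 2 * logb 2 (ν + 1)
        + 2 * logb 2 (1 / (ε ^ 2 * (1 - ε))) + 2 / ε + 8 := by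
  obtain ⟨A, l, alice, refA, hA, hPA, hl⟩ := hP.exists_compress_alice hcard hν hε hε1
  have hcardA : (Fintype.card Y * Fintype.card A : ℝ) ≤ 4 ^ ν := by
    refine le_trans ?_ hcard
    rw [mul_comm]
    gcongr
    exact Fintype.card_subtype_le _
  obtain ⟨B, l', bob, refB, hB, hPB, hl'⟩ := hPA.swap.exists_compress_alice hcardA hν hε hε1
  refine ⟨A, B, (mk l' l bob alice refB).swap, hA, hB, ?_, ?_⟩
  · rw [show δ + 4 * ε = δ + 2 * ε + 2 * ε by ring]
    exact hPB.swap
  · have hbob : chanInfo (mk l P.lenB alice P.bob refA).swap.alice = chanInfo P.bob := rfl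
    rw [hbob] at hl'
    rw [infoCost_uniformOfFintype, cost, Nat.cast_add]
    calc ((l : ℝ) + l') ≤ _ := add_le_add hl hl'
      _ = _ := by field_simp; ring

end Compression

end SimProtocol

open SimProtocol in
theorem mainTheorem6_general {X Y Z : Type*} [Fintype X] [Nonempty X] [Fintype Y] [Nonempty Y]
    (f : X → Y → Z) {δ ε ν : ℝ} (hδ : 0 ≤ δ) (hε : 0 < ε) (hε1 : ε < 1)
    (hcard : (Fintype.card X * Fintype.card Y : ℝ) ≤ 4 ^ ν) :
    ∃ (A : Finset X) (B : Finset Y),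
      (2 / 3 : ℝ) * Fintype.card X ≤ #A ∧ (2 / 3 : ℝ) * Fintype.card Y ≤ #B ∧
      ICsim δ f ≥ ε / 3 * (Rsim (δ + 4 * ε) (restrictRect f A B)
        - 2 * logb 2 (ν + 1) - 2 * logb 2 (1 / (ε ^ 2 * (1 - ε))) - 2 / ε - 8) ∧
      ∀ m : ℕ, Rsim δ (directSumFun m f) ≥ m * ε / 3 * (Rsim (δ + 4 * ε) (restrictRect f A B)
        - 2 * logb 2 (ν + 1) - 2 * logb 2 (1 / (ε ^ 2 * (1 - ε))) - 2 / ε - 8) := by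
  have hν : 0 ≤ ν := by
    by_contra! hneg
    have hpos : 0 < Fintype.card X * Fintype.card Y := Nat.mul_pos Fintype.card_pos Fintype.card_pos
    have hone : (1 : ℝ) ≤ Fintype.card X * Fintype.card Y := by exact_mod_cast hpos
    exact (hone.trans hcard).not_gt (rpow_lt_one_of_one_lt_of_neg (by norm_num) hneg)
  let large : Set (Finset X × Finset Y) :=
    {R | (2 / 3 : ℝ) * Fintype.card X ≤ #R.1 ∧ (2 / 3 : ℝ) * Fintype.card Y ≤ #R.2}
  have hlarge : (univ, univ) ∈ large := by
    constructor <;> rw [card_univ] <;> linarith [(Fintype.card X).cast_nonneg (α := ℝ)]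
  obtain ⟨⟨A, B⟩, ⟨hA, hB⟩, hmin⟩ := large.exists_min_image
    (fun R => Rsim (δ + 4 * ε) (restrictRect f R.1 R.2)) large.toFinite ⟨_, hlarge⟩
  have hIC : ε / 3 * (Rsim (δ + 4 * ε) (restrictRect f A B) - 2 * logb 2 (ν + 1)
      - 2 * logb 2 (1 / (ε ^ 2 * (1 - ε))) - 2 / ε - 8) ≤ ICsim δ f := by
    obtain ⟨P₀, hP₀⟩ := exists_computes f hδ
    refine le_csInf ⟨_, P₀, hP₀, rfl⟩ ?_
    rintro _ ⟨P, hP, rfl⟩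
    obtain ⟨A', B', Q, hA', hB', hQ, hcost⟩ := hP.exists_compress hcard hν hε hε1
    have hR : (Rsim (δ + 4 * ε) (restrictRect f A B) : ℝ) ≤ Q.cost := by
      exact_mod_cast (hmin (A', B') ⟨hA', hB'⟩).trans (Rsim_le_cost hQ)
    calc _ ≤ ε / 3 * (3 / ε * P.infoCost (PMF.uniformOfFintype (X × Y))) := by
          gcongr
          linarith
      _ = _ := by field_simp
  refine ⟨A, B, hA, hB, hIC, fun m => ?_⟩
  calc _ = m * (ε / 3 * (Rsim (δ + 4 * ε) (restrictRect f A B) - 2 * logb 2 (ν + 1)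
        - 2 * logb 2 (1 / (ε ^ 2 * (1 - ε))) - 2 / ε - 8)) := by ring
    _ ≤ m * ICsim δ f := by gcongr
    _ ≤ _ := mul_ICsim_le_Rsim_directSumFun f hδ m

theorem mainTheorem6 {n : ℕ} {Z : Type*} (f : (Fin n → Bool) → (Fin n → Bool) → Z)
    (δ ε : ℝ) (hδ : 0 < δ) (hε : 0 < ε) (hε1 : ε < 1) :
    (∃ GoodA GoodB : Finset (Fin n → Bool), IsLarge GoodA ∧ IsLarge GoodB ∧
      ICsim δ f ≥ ε / 3 * ((Rsim (δ + 4 * ε) (restrictRect f GoodA GoodB) : ℝ)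
        - 2 * Real.logb 2 (n + 1) - 2 * Real.logb 2 (1 / (ε ^ 2 * (1 - ε))) - 2 / ε - 8)) ∧
    (∀ m : ℕ, (Rsim δ (directSumFun m f) : ℝ) ≥ m * ε / 3 * ((RsimTilde (δ + 4 * ε) f : ℝ)
        - 2 * Real.logb 2 (n + 1) - 2 * Real.logb 2 (1 / (ε ^ 2 * (1 - ε))) - 2 / ε - 8)) := by
  have hcard : Fintype.card (Fin n → Bool) = 2 ^ n := by simp
  obtain ⟨A, B, hA, hB, hIC, hR⟩ := mainTheorem6_general f hδ.le hε hε1 (ν := n) (by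
    rw [hcard, rpow_natCast]
    push_cast
    rw [← mul_pow]
    norm_num)
  rw [hcard, Nat.cast_pow, Nat.cast_ofNat] at hA hB
  refine ⟨⟨A, B, hA, hB, hIC⟩, fun m => (hR m).le.trans' ?_⟩
  gcongr
  exact Nat.sInf_le ⟨A, B, hA, hB, rfl⟩
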